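/- Let $H$ be a finite-dimensional complex Hilbert space and $\|\cdot\|$ the operator norm. A Hamiltonian on $[0,T]$ is an integrable family $(V_t)_{t\in[0,T]}$ of self-adjoint operators; its propagator $U_t=\mathrm{Texp}\left(-i\int_0^t V_s\,ds\right)$ is the continuous solution of $U_t=1-i\int_0^t V_sU_s\,ds$ on $[0,T]$. For density operators $\rho,\sigma$ with the same spectrum (with multiplicities), the quantum charging distance is $$D(\rho,\sigma)=\min\left\{T\ge 0:\ \sigma=U_T\,\rho\,U_T^\dagger \text{ for the propagator } U \text{ of some Hamiltonian } V \text{ on } [0,T] \text{ with } \|V_t\|=1 \text{ for all } t\in[0,T]\right\}.$$ Let $\rho$ be a density operator on $H$, $T>0$, $V$ a Hamiltonian on $[0,T]$ with propagator $U$, $\rho_t=U_t\rho U_t^\dagger$ and $\sigma=\rho_T$. Put $$v_{CD}=\frac1T\int_0^T\|V_t\|\,dt,\qquad v_{mCD}=\frac1T\min_{D:\,[D_t,\rho_t]=0\ \forall t}\int_0^T\|V_t+D_t\|\,dt,$$ where the minimum is over all Hamiltonians $D$ on $[0,T]$ with $[D_t,\rho_t]=0$ for all $t\in[0,T]$. Let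 $t_{CD}=D(\rho,\sigma)/v_{CD}$ and $t_{mCD}=D(\rho,\sigma)/v_{mCD}$ (read as $0$ if the denominator vanishes). Then: 1. The minima defining $D(\rho,\sigma)$ and $v_{mCD}$ are attained. 2. $D(\rho,\sigma)\le T\,v_{mCD}=\min_{D:\,[D_t,\rho_t]=0}\int_0^T\|V_t+D_t\|\,dt$, and hence $t_{mCD}\le T$. 3. $D(\rho,\sigma)\le T\,v_{CD}=\int_0^T\|V_t\|\,dt$, and $t_{CD}\le t_{mCD}\le T$. 4. The bound $t_{CD}$ is achievable: for every $T'>0$ there is a Hamiltonian $V'$ on $[0,T']$ whose propagator takes $\rho$ to $\sigma$ in time $T'$ and for which $\int_0^{T'}\|V'_t\|\,dt=D(\rho,\sigma)$; if $\rho\ne\sigma$, then $t_{CD}=T'$ for this evolution. -/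

import Mathlib

noncomputable section

namespace QuantumCharging

open MeasureTheory Set

variable {H : Type*} [NormedAddCommGroup H] [InnerProductSpace ℂ H] [CompleteSpace H]

/-- Density operators: positive operators of trace one (on a finite-dimensional space). -/
structure IsDensity (ρ : H →L[ℂ] H) : Prop where
  pos : ρ.IsPositive
  trace_one : LinearMap.trace ℂ H (ρ : H →ₗ[ℂ] H) = 1

/-- A time-dependent Hamiltonian on `[0, T]`: self-adjoint at every time and integrable in time. -/
structure IsHamiltonian (T : ℝ) (V : ℝ → H →L[ℂ] H) : Prop where
  selfAdjoint : ∀ t ∈ Icc 0 T, IsSelfAdjoint (V t)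
  integrable : IntervalIntegrable V volume 0 T

/-- `U t = Texp (-i ∫₀ᵗ V_s ds)` for `t ∈ [0, T]`: the time-ordered exponential is the continuous
solution of the Schrödinger equation `U' = -i V U`, `U 0 = 1`, in integral form. -/
structure IsPropagator (T : ℝ) (V U : ℝ → H →L[ℂ] H) : Prop where
  continuousOn : ContinuousOn U (Icc 0 T)
  schrodinger : ∀ t ∈ Icc 0 T, U t = 1 - Complex.I • ∫ s in (0 : ℝ)..t, V s * U s

/-- The state `ρ_t = U_t ρ U_t†`. -/
def state (U : ℝ → H →L[ℂ] H) (ρ : H →L[ℂ] H) (t : ℝ) : H →L[ℂ] H :=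
  U t * ρ * star (U t)

/-- The times `T` in which `ρ` can be driven to `σ` by a Hamiltonian with `‖V_t‖ = 1`
(operator norm) throughout. -/
def chargingTimes (ρ σ : H →L[ℂ] H) : Set ℝ :=
  {T | 0 ≤ T ∧ ∃ V U : ℝ → H →L[ℂ] H, IsHamiltonian T V ∧ (∀ t ∈ Icc 0 T, ‖V t‖ = 1) ∧
    IsPropagator T V U ∧ state U ρ T = σ}

/-- The quantum charging distance: the least charging time. -/
def chargingDistance (ρ σ : H →L[ℂ] H) : ℝ :=
  sInf (chargingTimes ρ σ)

/-- The values `∫₀ᵀ ‖V_t + D_t‖ dt`, over all time-dependent Hamiltonians `D` with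
`[D_t, ρ_t] = 0` for all `t`; here `r t` stands for `ρ_t`. -/
def modifiedCosts (T : ℝ) (V r : ℝ → H →L[ℂ] H) : Set ℝ :=
  {c | ∃ D : ℝ → H →L[ℂ] H, IsHamiltonian T D ∧ (∀ t ∈ Icc 0 T, Commute (D t) (r t)) ∧
    c = ∫ t in (0 : ℝ)..T, ‖V t + D t‖}

/-- The speed `v_CD`. -/
def vCD (T : ℝ) (V : ℝ → H →L[ℂ] H) : ℝ :=
  1 / T * ∫ t in (0 : ℝ)..T, ‖V t‖

/-- The modified speed `v_mCD`. -/
def vmCD (T : ℝ) (V r : ℝ → H →L[ℂ] H) : ℝ :=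
  1 / T * sInf (modifiedCosts T V r)

/-- The time `t_CD` for an evolution that starts in `ρ` and ends in `σ`. -/
def tCD (T : ℝ) (V : ℝ → H →L[ℂ] H) (ρ σ : H →L[ℂ] H) : ℝ :=
  chargingDistance ρ σ / vCD T V

/-- The time `t_mCD` for an evolution `r` that starts in `ρ` and ends in `σ`. -/
def tmCD (T : ℝ) (V r : ℝ → H →L[ℂ] H) (ρ σ : H →L[ℂ] H) : ℝ :=
  chargingDistance ρ σ / vmCD T V r

end QuantumCharging

end

/-! ### Angles between unit vectors and logarithms of unitaries. -/

noncomputable section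
namespace QuantumCharging
open MeasureTheory Set
variable {H : Type*} [NormedAddCommGroup H] [InnerProductSpace ℂ H]

/-! The charging distance is the least norm of a self-adjoint `A` for which `exp (-iA)` conjugates
`ρ` to `σ`. The constant Hamiltonians `A / ‖A‖` and `A / T'` give attainment and achievability, so
all rests on one bound: if `D_t` commutes with `ρ_t`, some such `A` satisfies `‖A‖ ≤ ∫ ‖V + D‖`.

The bound is geometric. On a short interval the state moves, up to a quadratic error, by conjugation
with `exp (-i ∫ (V + D))`, which turns unit vectors by at most `∫ ‖V + D‖`. Angles add along
products, and repeated halving of the interval makes the total error vanish; compactness of the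
unitary group then gives an exact `W` (`exists_unitary_of_evolution`). The propagator of `V + D` is
never needed. An eigenvector of `W` with eigenvalue `z` is turned by `|arg z|`, so the principal
logarithm of `W` is short enough (`exists_selfAdjoint_log`).

The minimum over `D` is attained pointwise in time by a Borel selection of best approximations
(`exists_measurable_best_approximation`), carried along by conjugation with `U_t`. -/

/-- The angle between two unit vectors, for the underlying real inner product. -/
def sphereAngle (x y : H) : ℝ := Real.arccos (inner ℂ x y).re

theorem sphereAngle_eq_angle {x y : H} (hx : ‖x‖ = 1) (hy : ‖y‖ = 1) :
    sphereAngle x y =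
      @InnerProductGeometry.angle H _ (InnerProductSpace.rclikeToReal ℂ H) x y := by
  let := InnerProductSpace.rclikeToReal ℂ H
  rw [InnerProductGeometry.angle, hx, hy, mul_one, div_one]
  rfl

theorem sphereAngle_triangle {x y z : H} (hx : ‖x‖ = 1) (hy : ‖y‖ = 1) (hz : ‖z‖ = 1) :
    sphereAngle x z ≤ sphereAngle x y + sphereAngle y z := by
  let := InnerProductSpace.rclikeToReal ℂ H
  rw [sphereAngle_eq_angle hx hy, sphereAngle_eq_angle hx hz, sphereAngle_eq_angle hy hz]
  exact InnerProductGeometry.angle_le_angle_add_angle x y z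

theorem le_sin_add_sq {x : ℝ} (h0 : 0 ≤ x) (hx : x ≤ Real.pi / 2) :
    x ≤ Real.sin x + 2 * Real.sin x ^ 2 := by
  rcases h0.eq_or_lt with rfl | h0
  · simp
  have h1 := Real.sin_gt_sub_cube h0
  have h2 := Real.mul_le_sin h0.le hx
  have h3 : x / 2 ≤ Real.sin x := by
    refine le_trans ?_ h2
    have : (1 / 2 : ℝ) ≤ 2 / Real.pi := by
      rw [div_le_div_iff₀ (by norm_num) Real.pi_pos]; linarith [Real.pi_lt_four]
    nlinarith
  have h4 : x ≤ 2 := by linarith [Real.pi_lt_four]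
  have h5 : (x / 2) ^ 2 ≤ Real.sin x ^ 2 := pow_le_pow_left₀ (by positivity) h3 2
  nlinarith [mul_nonneg (sq_nonneg x) (by linarith : (0 : ℝ) ≤ 2 - x)]

/-- The chord is `2 sin (θ / 2)`. Arc and chord differ only to second order, which is harmless under
subdivision. -/
theorem sphereAngle_le_chord {x y : H} (hx : ‖x‖ = 1) (hy : ‖y‖ = 1) :
    sphereAngle x y ≤ ‖x - y‖ + ‖x - y‖ ^ 2 := by
  set θ := sphereAngle x y with hθ
  have h0 : 0 ≤ θ := Real.arccos_nonneg _
  have hpi : θ ≤ Real.pi := Real.arccos_le_pi _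
  have hin : |(inner ℂ x y).re| ≤ 1 := by
    refine (Complex.abs_re_le_norm _).trans ((norm_inner_le_norm x y).trans ?_)
    rw [hx, hy, one_mul]
  have hcos : Real.cos θ = (inner ℂ x y).re :=
    Real.cos_arccos (abs_le.1 hin).1 (abs_le.1 hin).2
  have hs : 0 ≤ Real.sin (θ / 2) :=
    Real.sin_nonneg_of_nonneg_of_le_pi (by linarith) (by linarith)
  have hn : ‖x - y‖ ^ 2 = (2 * Real.sin (θ / 2)) ^ 2 := by
    have h1 := norm_sub_sq (𝕜 := ℂ) x y
    have h2 : Real.cos θ = 1 - 2 * Real.sin (θ / 2) ^ 2 := by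
      have := Real.cos_two_mul (θ / 2)
      rw [mul_div_cancel₀ _ (two_ne_zero)] at this
      rw [this, Real.cos_sq']; ring
    rw [h1, hx, hy, show RCLike.re (inner ℂ x y) = (inner ℂ x y).re from rfl, ← hcos, h2]
    ring
  have hn' : ‖x - y‖ = 2 * Real.sin (θ / 2) :=
    (pow_left_inj₀ (norm_nonneg _) (by positivity) two_ne_zero).1 hn
  rw [hn']
  have := le_sin_add_sq (x := θ / 2) (by linarith) (by linarith)
  linarith

theorem spectrum_eq_spectrum_toLinearMap [FiniteDimensional ℂ H] (W : H →L[ℂ] H) :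
    spectrum ℂ W = spectrum ℂ (W : H →ₗ[ℂ] H) := by
  have := AlgEquiv.spectrum_eq (Module.End.toContinuousLinearMap H (𝕜 := ℂ)) (W : H →ₗ[ℂ] H)
  rw [← this]
  congr 1

/-- Unitarity of `U` comes only later, out of the main estimate; until then a uniform bound `C`
replaces it. -/
theorem IsPropagator.exists_bound {T : ℝ} {V U : ℝ → H →L[ℂ] H} (hU : IsPropagator T V U) :
    ∃ C, 0 ≤ C ∧ ∀ t ∈ Icc 0 T, ‖U t‖ ≤ C := by
  obtain ⟨C, hC⟩ := isCompact_Icc.exists_bound_of_continuousOn hU.continuousOn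
  exact ⟨max C 0, le_max_right _ _, fun t ht => (hC t ht).trans (le_max_left _ _)⟩

theorem IsPropagator.of_le {T t : ℝ} {V U : ℝ → H →L[ℂ] H} (hU : IsPropagator T V U)
    (ht : t ∈ Icc 0 T) : IsPropagator t V U :=
  ⟨hU.continuousOn.mono (Icc_subset_Icc_right ht.2),
    fun s hs => hU.schrodinger s ⟨hs.1, hs.2.trans ht.2⟩⟩

theorem IsDensity.nontrivial {ρ : H →L[ℂ] H} (hρ : IsDensity ρ) : Nontrivial H := by
  by_contra h
  rw [not_nontrivial_iff_subsingleton] at h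
  have h0 : (ρ : H →ₗ[ℂ] H) = 0 := Subsingleton.elim _ _
  have := hρ.trace_one
  rw [h0, map_zero] at this
  exact zero_ne_one this

variable [CompleteSpace H]

theorem norm_apply_of_mem_unitary {W : H →L[ℂ] H} (hW : W ∈ unitary (H →L[ℂ] H)) (x : H) :
    ‖W x‖ = ‖x‖ :=
  Unitary.norm_map ⟨W, hW⟩ x

theorem sphereAngle_map {W : H →L[ℂ] H} (hW : W ∈ unitary (H →L[ℂ] H)) (x y : H) :
    sphereAngle (W x) (W y) = sphereAngle x y := by
  unfold sphereAngle
  rw [Unitary.inner_map_map ⟨W, hW⟩ x y]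

theorem exp_neg_I_smul_mem_unitary {A : H →L[ℂ] H} (hA : IsSelfAdjoint A) :
    NormedSpace.exp (-(Complex.I • A)) ∈ unitary (H →L[ℂ] H) := by
  have := (selfAdjoint.expUnitary (-(⟨A, hA⟩ : selfAdjoint (H →L[ℂ] H)))).2
  simpa [selfAdjoint.expUnitary_coe] using this

theorem star_neg_I_smul {A : H →L[ℂ] H} (hA : IsSelfAdjoint A) :
    star (-(Complex.I • A)) = Complex.I • A := by
  simp [hA.star_eq]

/-- For normal `X` the functional calculus reduces this to the scalar estimate on the disc of radius
`‖X‖`. -/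
theorem norm_exp_sub_one_sub_le {X : H →L[ℂ] H} [IsStarNormal X] (hX : ‖X‖ ≤ 1) :
    ‖NormedSpace.exp X - 1 - X‖ ≤ ‖X‖ ^ 2 := by
  have h : NormedSpace.exp X - 1 - X = cfc (fun z : ℂ => Complex.exp z - 1 - z) X := by
    rw [cfc_sub (fun z : ℂ => Complex.exp z - 1) (fun z => z) X,
      cfc_sub (fun z : ℂ => Complex.exp z) (fun _ => 1) X, cfc_id' ℂ X, cfc_const_one ℂ X,
      CFC.complex_exp_eq_normedSpace_exp]
  rw [h]
  refine norm_cfc_le (by positivity) fun z hz => ?_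
  have hz' : ‖z‖ ≤ ‖X‖ := (spectrum.norm_le_norm_mul_of_mem hz).trans
    (mul_le_of_le_one_right (norm_nonneg _) ContinuousLinearMap.norm_id_le)
  exact (Complex.norm_exp_sub_one_sub_id_le (hz'.trans hX)).trans
    (pow_le_pow_left₀ (norm_nonneg _) hz' 2)

variable [FiniteDimensional ℂ H]

/-- A unitary that turns every vector by an angle of at most `L` is `exp (-iA)` with a
self-adjoint `A` of norm at most `L`. -/
theorem exists_selfAdjoint_log {W : H →L[ℂ] H} (hW : W ∈ unitary (H →L[ℂ] H)) {L : ℝ}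
    (hL0 : 0 ≤ L) (hL : ∀ x : H, ‖x‖ = 1 → sphereAngle x (W x) ≤ L) :
    ∃ A : H →L[ℂ] H, IsSelfAdjoint A ∧ ‖A‖ ≤ L ∧ NormedSpace.exp (-(Complex.I • A)) = W := by
  have hnormal : IsStarNormal W := ⟨by
    rw [Commute, SemiconjBy, (Unitary.mem_iff.1 hW).1, (Unitary.mem_iff.1 hW).2]⟩
  have hfin : (spectrum ℂ W).Finite := by
    rw [spectrum_eq_spectrum_toLinearMap]
    exact Module.End.finite_spectrum _
  -- On a finite spectrum every function is continuous, so the branch cut of `arg` does no harm.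
  have hcont (f : ℂ → ℂ) : ContinuousOn f (spectrum ℂ W) := hfin.continuousOn f
  have hunit : ∀ z ∈ spectrum ℂ W, ‖z‖ = 1 := fun z hz => by
    simpa using spectrum.subset_circle_of_unitary hW hz
  have harg : ∀ z ∈ spectrum ℂ W, |z.arg| ≤ L := by
    intro z hz
    have hz1 := hunit z hz
    rw [spectrum_eq_spectrum_toLinearMap, ← Module.End.hasEigenvalue_iff_mem_spectrum] at hz
    obtain ⟨v, hv⟩ := hz.exists_hasEigenvector
    have hv0 : ‖v‖ ≠ 0 := norm_ne_zero_iff.2 hv.2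
    set x : H := ((‖v‖⁻¹ : ℝ) : ℂ) • v with hx
    have hx1 : ‖x‖ = 1 := by
      rw [hx, norm_smul, Complex.norm_real, norm_inv, norm_norm, inv_mul_cancel₀ hv0]
    have hWx : W x = z • x := by
      have : W v = z • v := hv.apply_eq_smul
      rw [hx, map_smul, this, smul_comm]
    -- The real angle between `x` and `z • x` is `|arg z|`.
    have h := hL x hx1
    rw [sphereAngle, hWx, inner_smul_right, inner_self_eq_norm_sq_to_K, hx1] at h
    have h2 := Complex.angle_one_left (y := z) (by rintro rfl; simp at hz1)
    rw [← h2, InnerProductGeometry.angle, hz1]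
    simpa using h
  have hexp : W = NormedSpace.exp (Complex.I • cfc (fun z : ℂ => (z.arg : ℂ)) W) := by
    rw [← cfc_smul Complex.I (fun z : ℂ => (z.arg : ℂ)) W (hcont _),
      ← CFC.complex_exp_eq_normedSpace_exp,
      ← cfc_comp' Complex.exp _ W (by fun_prop) (hcont _)]
    conv_lhs => rw [← cfc_id' ℂ W]
    refine cfc_congr fun z hz => ?_
    have := Complex.norm_mul_exp_arg_mul_I z
    rw [hunit z hz, Complex.ofReal_one, one_mul] at this
    simp only [smul_eq_mul]
    rw [mul_comm, this]
  refine ⟨-cfc (fun z : ℂ => (z.arg : ℂ)) W, ?_, ?_, ?_⟩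
  · rw [IsSelfAdjoint, star_neg, ← cfc_star]
    simp
  · rw [norm_neg]
    exact norm_cfc_le hL0 fun z hz => by simpa using harg z hz
  · rw [smul_neg, neg_neg]
    exact hexp.symm

end QuantumCharging
end

/-! ### Evolution over a short time, up to quadratic errors. -/

noncomputable section
namespace QuantumCharging
open MeasureTheory Set
variable {H : Type*} [NormedAddCommGroup H] [InnerProductSpace ℂ H] [CompleteSpace H]

theorem norm_star_eq (X : H →L[ℂ] H) : ‖star X‖ = ‖X‖ := norm_star X

theorem norm_mul_mul_le {X Y Z : H →L[ℂ] H} {a b c : ℝ} (hX : ‖X‖ ≤ a) (hY : ‖Y‖ ≤ b)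
    (hZ : ‖Z‖ ≤ c) : ‖X * Y * Z‖ ≤ a * b * c := by
  have ha := (norm_nonneg X).trans hX
  have hb := (norm_nonneg Y).trans hY
  refine (norm_mul_le _ _).trans (mul_le_mul ((norm_mul_le _ _).trans ?_) hZ (norm_nonneg _)
    (by positivity))
  exact mul_le_mul hX hY (norm_nonneg _) ha

theorem isStarNormal_neg_I_smul {B : H →L[ℂ] H} (hB : IsSelfAdjoint B) :
    IsStarNormal (-(Complex.I • B)) := ⟨by
  rw [star_neg_I_smul hB]
  exact (Commute.refl _).neg_right⟩

/-- Conjugation by `exp (-iB)` to first order in `B`. -/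
theorem norm_conj_exp_sub_le {B r : H →L[ℂ] H} (hB : IsSelfAdjoint B) {Δ R : ℝ}
    (hBΔ : ‖B‖ ≤ Δ) (hΔ : Δ ≤ 1) (hr : ‖r‖ ≤ R) :
    ‖NormedSpace.exp (-(Complex.I • B)) * r * star (NormedSpace.exp (-(Complex.I • B))) -
      (r - Complex.I • (B * r - r * B))‖ ≤ 6 * R * Δ ^ 2 := by
  have := isStarNormal_neg_I_smul hB
  have hΔ0 : 0 ≤ Δ := (norm_nonneg _).trans hBΔ
  have hR0 : 0 ≤ R := (norm_nonneg _).trans hr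
  have hXn : ‖-(Complex.I • B)‖ = ‖B‖ := by simp [norm_smul]
  have hX : ‖-(Complex.I • B)‖ ≤ Δ := hXn.trans_le hBΔ
  have hh := norm_exp_sub_one_sub_le (hX.trans hΔ)
  have hXstar := star_neg_I_smul hB
  set X := -(Complex.I • B) with hXdef
  set h := NormedSpace.exp X - 1 - X with hhdef
  have hh' : ‖h‖ ≤ Δ ^ 2 := hh.trans (pow_le_pow_left₀ (norm_nonneg _) hX 2)
  have hw : ‖X + h‖ ≤ 2 * Δ := (norm_add_le _ _).trans (by nlinarith)
  have hE : NormedSpace.exp X = 1 + (X + h) := by rw [hhdef]; abel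
  -- With `exp X = 1 + (X + h)` the terms of order zero and one cancel. The remaining three are at
  -- most `RΔ²`, `RΔ²` and `4RΔ²`.
  have key : NormedSpace.exp X * r * star (NormedSpace.exp X) -
      (r - Complex.I • (B * r - r * B)) =
      h * r * 1 + 1 * r * star h + (X + h) * r * star (X + h) := by
    have h1 : Complex.I • B = star X := hXstar.symm
    have h2 : X = - star X := by rw [← h1]
    have h3 : Complex.I • (B * r - r * B) = -(X * r) - r * star X := by
      rw [smul_sub, ← smul_mul_assoc, ← mul_smul_comm, h1]
      nth_rw 3 [h2]
      simp
    rw [hE, h3]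
    simp only [star_add, star_one]
    noncomm_ring
  rw [key]
  have h1 : ‖(1 : H →L[ℂ] H)‖ ≤ 1 := ContinuousLinearMap.norm_id_le
  have e1 := norm_mul_mul_le hh' hr h1
  have e2 := norm_mul_mul_le h1 hr ((norm_star_eq h).trans_le hh')
  have e3 := norm_mul_mul_le hw hr ((norm_star_eq (X + h)).trans_le hw)
  refine (norm_add₃_le).trans ?_
  nlinarith

theorem norm_exp_neg_I_smul_sub_one_le {B : H →L[ℂ] H} (hB : IsSelfAdjoint B) (h : ‖B‖ ≤ 1) :
    ‖NormedSpace.exp (-(Complex.I • B)) - 1‖ ≤ ‖B‖ + ‖B‖ ^ 2 := by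
  have := isStarNormal_neg_I_smul hB
  have hXn : ‖-(Complex.I • B)‖ = ‖B‖ := by simp [norm_smul]
  have hh := norm_exp_sub_one_sub_le (hXn.trans_le h)
  rw [hXn] at hh
  calc _ = ‖(-(Complex.I • B)) +
        (NormedSpace.exp (-(Complex.I • B)) - 1 - (-(Complex.I • B)))‖ := by congr 1; abel
    _ ≤ _ := (norm_add_le _ _).trans (by rw [hXn]; linarith)

/-- `exp (-iB)` turns unit vectors by at most `‖B‖`, up to a quadratic error. -/
theorem sphereAngle_exp_le {B : H →L[ℂ] H} (hB : IsSelfAdjoint B) {b Δ : ℝ} (hb : ‖B‖ ≤ b)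
    (hbΔ : b ≤ Δ) (hΔ : Δ ≤ 1) {x : H} (hx : ‖x‖ = 1) :
    sphereAngle x (NormedSpace.exp (-(Complex.I • B)) x) ≤ b + 5 * Δ ^ 2 := by
  have hW := exp_neg_I_smul_mem_unitary hB
  have h1 := norm_exp_neg_I_smul_sub_one_le hB (hb.trans (hbΔ.trans hΔ))
  set W := NormedSpace.exp (-(Complex.I • B)) with hWdef
  have h2 : ‖x - W x‖ ≤ b + b ^ 2 := by
    rw [norm_sub_rev]
    have := (W - 1).le_opNorm x
    rw [hx, mul_one] at this
    refine (this.trans h1).trans ?_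
    have := norm_nonneg B
    gcongr
  have h3 := sphereAngle_le_chord hx ((norm_apply_of_mem_unitary hW x).trans hx)
  have hb0 := (norm_nonneg B).trans hb
  have h4 : b ^ 2 ≤ Δ ^ 2 := pow_le_pow_left₀ hb0 hbΔ 2
  have h5 : b + b ^ 2 ≤ 2 * Δ := by nlinarith
  have h6 : ‖x - W x‖ ^ 2 ≤ (2 * Δ) ^ 2 := pow_le_pow_left₀ (norm_nonneg _) (h2.trans h5) 2
  nlinarith

theorem norm_integral_mul_le {V X : ℝ → H →L[ℂ] H} {s t c : ℝ} (hst : s ≤ t)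
    (hV : IntervalIntegrable V volume s t) (hX : ∀ u ∈ Icc s t, ‖X u‖ ≤ c) :
    ‖∫ u in s..t, V u * X u‖ ≤ (∫ u in s..t, ‖V u‖) * c := by
  rw [← intervalIntegral.integral_mul_const]
  refine intervalIntegral.norm_integral_le_of_norm_le hst ?_ (hV.norm.mul_const c)
  filter_upwards with u hu
  exact (norm_mul_le _ _).trans
    (mul_le_mul_of_nonneg_left (hX u (Ioc_subset_Icc_self hu)) (norm_nonneg _))

theorem isSelfAdjoint_integral {V : ℝ → H →L[ℂ] H} {s t : ℝ} (hst : s ≤ t)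
    (hV : ∀ u ∈ Icc s t, IsSelfAdjoint (V u)) : IsSelfAdjoint (∫ u in s..t, V u) := by
  rw [IsSelfAdjoint, intervalIntegral.integral_of_le hst]
  have h := ((starL' ℝ : (H →L[ℂ] H) ≃L[ℝ] (H →L[ℂ] H))).integral_comp_comm
    (μ := volume.restrict (Ioc s t)) V
  simp only [starL'_apply] at h
  rw [← h]
  exact setIntegral_congr_fun measurableSet_Ioc fun u hu => hV u (Ioc_subset_Icc_self hu)

theorem IsHamiltonian.mono {T : ℝ} {V : ℝ → H →L[ℂ] H} (hV : IsHamiltonian T V) {s t : ℝ}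
    (hs : s ∈ Icc 0 T) (ht : t ∈ Icc 0 T) : IntervalIntegrable V volume s t := by
  have h0 : (0 : ℝ) ≤ T := hs.1.trans hs.2
  exact hV.integrable.mono_set (by
    rw [uIcc_of_le h0]; exact uIcc_subset_Icc hs ht)

theorem IsPropagator.integrable_mul {T : ℝ} {V U : ℝ → H →L[ℂ] H} (hV : IsHamiltonian T V)
    (hU : IsPropagator T V U) {s t : ℝ} (hs : s ∈ Icc 0 T) (ht : t ∈ Icc 0 T) :
    IntervalIntegrable (fun u => V u * U u) volume s t :=
  (hV.mono hs ht).mul_continuousOn (hU.continuousOn.mono (uIcc_subset_Icc hs ht))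

theorem IsPropagator.sub_eq {T : ℝ} {V U : ℝ → H →L[ℂ] H} (hV : IsHamiltonian T V)
    (hU : IsPropagator T V U) {s t : ℝ} (hs : s ∈ Icc 0 T) (ht : t ∈ Icc 0 T) :
    U t - U s = -(Complex.I • ∫ u in s..t, V u * U u) := by
  have h0 : (0 : ℝ) ∈ Icc 0 T := ⟨le_rfl, hs.1.trans hs.2⟩
  rw [hU.schrodinger t ht, hU.schrodinger s hs,
    ← intervalIntegral.integral_add_adjacent_intervals (hU.integrable_mul hV h0 hs)
      (hU.integrable_mul hV hs ht), smul_add]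
  abel

theorem IsPropagator.norm_sub_le {T : ℝ} {V U : ℝ → H →L[ℂ] H} (hV : IsHamiltonian T V)
    (hU : IsPropagator T V U) {C : ℝ} (hC : ∀ t ∈ Icc 0 T, ‖U t‖ ≤ C) {s t : ℝ}
    (hs : s ∈ Icc 0 T) (ht : t ∈ Icc 0 T) (hst : s ≤ t) :
    ‖U t - U s‖ ≤ (∫ u in s..t, ‖V u‖) * C := by
  rw [hU.sub_eq hV hs ht, norm_neg, norm_smul, Complex.norm_I, one_mul]
  exact norm_integral_mul_le hst (hV.mono hs ht) fun u hu => hC u (Icc_subset_Icc hs.1 ht.2 hu)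

/-- The remainder is `-i ∫ V_u (U_u - U_s) du`, and `U_u - U_s` is itself at most `C ∫ ‖V‖`;
integrability of `V` is enough. -/
theorem IsPropagator.norm_sub_linear_le {T : ℝ} {V U : ℝ → H →L[ℂ] H} (hV : IsHamiltonian T V)
    (hU : IsPropagator T V U) {C : ℝ} (hC0 : 0 ≤ C) (hC : ∀ t ∈ Icc 0 T, ‖U t‖ ≤ C) {s t : ℝ}
    (hs : s ∈ Icc 0 T) (ht : t ∈ Icc 0 T) (hst : s ≤ t) :
    ‖U t - U s + Complex.I • ((∫ u in s..t, V u) * U s)‖ ≤ (∫ u in s..t, ‖V u‖) ^ 2 * C := by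
  have h1 : (∫ u in s..t, V u) * U s = ∫ u in s..t, V u * U s := by
    have := ((ContinuousLinearMap.mul ℝ (H →L[ℂ] H)).flip (U s)).intervalIntegral_comp_comm
      (hV.mono hs ht)
    simpa using this.symm
  have h2 : U t - U s + Complex.I • ((∫ u in s..t, V u) * U s) =
      -(Complex.I • ∫ u in s..t, V u * (U u - U s)) := by
    rw [hU.sub_eq hV hs ht, h1]
    simp only [mul_sub]
    rw [intervalIntegral.integral_sub (hU.integrable_mul hV hs ht)
      ((hV.mono hs ht).mul_continuousOn continuousOn_const), smul_sub]
    abel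
  rw [h2, norm_neg, norm_smul, Complex.norm_I, one_mul]
  have h3 := norm_integral_mul_le (X := fun u => U u - U s) (c := (∫ u in s..t, ‖V u‖) * C) hst
    (hV.mono hs ht) fun u hu => by
      have hu' := Icc_subset_Icc hs.1 ht.2 hu
      refine (hU.norm_sub_le hV hC hs hu' hu.1).trans (mul_le_mul_of_nonneg_right ?_ hC0)
      refine intervalIntegral.integral_mono_interval le_rfl hu.1 hu.2
        (Filter.Eventually.of_forall fun _ => norm_nonneg _) (hV.mono hs ht).norm
  refine h3.trans_eq (by ring)

theorem norm_state_le {U : ℝ → H →L[ℂ] H} {ρ : H →L[ℂ] H} {C t : ℝ} (hC : ‖U t‖ ≤ C) :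
    ‖state U ρ t‖ ≤ C * ‖ρ‖ * C :=
  norm_mul_mul_le hC le_rfl ((norm_star_eq _).trans_le hC)

theorem norm_state_sub_le {U : ℝ → H →L[ℂ] H} {ρ : H →L[ℂ] H} {C Δ s t : ℝ}
    (hs : ‖U s‖ ≤ C) (ht : ‖U t‖ ≤ C) (hst : ‖U t - U s‖ ≤ Δ * C) :
    ‖state U ρ t - state U ρ s‖ ≤ 2 * (C * ‖ρ‖ * C) * Δ := by
  have : state U ρ t - state U ρ s =
      (U t - U s) * ρ * star (U t) + U s * ρ * star (U t - U s) := by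
    simp only [state, star_sub]; noncomm_ring
  rw [this]
  have e1 := norm_mul_mul_le hst (le_refl ‖ρ‖) ((norm_star_eq _).trans_le ht)
  have e2 := norm_mul_mul_le hs (le_refl ‖ρ‖) ((norm_star_eq _).trans_le hst)
  refine (norm_add_le _ _).trans ?_
  linarith

/-- The von Neumann equation to first order in time, with a Hamiltonian changed by a term that
commutes with the state. -/
theorem norm_state_sub_commutator_le {T : ℝ} {V U D : ℝ → H →L[ℂ] H} {ρ : H →L[ℂ] H}
    (hV : IsHamiltonian T V) (hU : IsPropagator T V U) (hD : IsHamiltonian T D)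
    (hcomm : ∀ t ∈ Icc 0 T, Commute (D t) (state U ρ t)) {C : ℝ} (hC0 : 0 ≤ C)
    (hC : ∀ t ∈ Icc 0 T, ‖U t‖ ≤ C) {s t : ℝ}
    (hs : s ∈ Icc 0 T) (ht : t ∈ Icc 0 T) (hst : s ≤ t) {Δ : ℝ}
    (hΔ : (∫ u in s..t, (‖V u‖ + ‖D u‖)) = Δ) :
    ‖state U ρ t - (state U ρ s - Complex.I •
      ((∫ u in s..t, (V u + D u)) * state U ρ s - state U ρ s * ∫ u in s..t, (V u + D u)))‖ ≤
      7 * (C * ‖ρ‖ * C) * Δ ^ 2 := by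
  rw [intervalIntegral.integral_add (hV.mono hs ht).norm (hD.mono hs ht).norm] at hΔ
  rw [intervalIntegral.integral_add (hV.mono hs ht) (hD.mono hs ht)]
  have hv0 : 0 ≤ ∫ u in s..t, ‖V u‖ := intervalIntegral.integral_nonneg hst fun _ _ => norm_nonneg _
  have hd0 : 0 ≤ ∫ u in s..t, ‖D u‖ := intervalIntegral.integral_nonneg hst fun _ _ => norm_nonneg _
  set v := ∫ u in s..t, ‖V u‖ with hv
  set d := ∫ u in s..t, ‖D u‖ with hd
  have hsub := hU.norm_sub_le hV hC hs ht hst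
  have hlin := hU.norm_sub_linear_le hV hC0 hC hs ht hst
  have hBsa : IsSelfAdjoint (∫ u in s..t, V u) := isSelfAdjoint_integral hst fun u hu =>
    hV.selfAdjoint u (Icc_subset_Icc hs.1 ht.2 hu)
  -- `D u` commutes with the state at time `u`, not at time `s`; the commutator therefore sees only
  -- the change of state between them, and is of second order.
  have hDcomm : ‖(∫ u in s..t, D u) * state U ρ s - state U ρ s * ∫ u in s..t, D u‖ ≤
      4 * (C * ‖ρ‖ * C) * v * d := by
    have h1 : (∫ u in s..t, D u) * state U ρ s - state U ρ s * ∫ u in s..t, D u =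
        ∫ u in s..t, (D u * state U ρ s - state U ρ s * D u) := by
      have := ((ContinuousLinearMap.mul ℝ (H →L[ℂ] H)).flip (state U ρ s) -
        ContinuousLinearMap.mul ℝ (H →L[ℂ] H) (state U ρ s)).intervalIntegral_comp_comm
        (hD.mono hs ht)
      simpa using this.symm
    rw [h1, hd, ← intervalIntegral.integral_const_mul]
    refine intervalIntegral.norm_integral_le_of_norm_le hst ?_ ((hD.mono hs ht).norm.const_mul _)
    filter_upwards with u hu
    have hu := Ioc_subset_Icc_self hu
    have hu' := Icc_subset_Icc hs.1 ht.2 hu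
    have hc : D u * state U ρ s - state U ρ s * D u =
        -(D u * (state U ρ u - state U ρ s)) + (state U ρ u - state U ρ s) * D u := by
      have := (hcomm u hu').eq
      rw [mul_sub, sub_mul, this]; abel
    have hn : ‖state U ρ u - state U ρ s‖ ≤ 2 * (C * ‖ρ‖ * C) * v := by
      refine norm_state_sub_le (hC s hs) (hC u hu') ?_
      refine (hU.norm_sub_le hV hC hs hu' hu.1).trans (mul_le_mul_of_nonneg_right ?_ hC0)
      exact intervalIntegral.integral_mono_interval le_rfl hu.1 hu.2
        (Filter.Eventually.of_forall fun _ => norm_nonneg _) (hV.mono hs ht).norm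
    rw [hc]
    refine (norm_add_le _ _).trans ?_
    rw [norm_neg]
    have e1 := (norm_mul_le (D u) (state U ρ u - state U ρ s)).trans
      (mul_le_mul_of_nonneg_left hn (norm_nonneg _))
    have e2 := (norm_mul_le (state U ρ u - state U ρ s) (D u)).trans
      (mul_le_mul_of_nonneg_right hn (norm_nonneg _))
    linarith
  set B := ∫ u in s..t, V u with hB
  set E := ∫ u in s..t, D u with hE
  set e := U t - U s + Complex.I • (B * U s) with he
  have key : state U ρ t - (state U ρ s - Complex.I •
      ((B + E) * state U ρ s - state U ρ s * (B + E))) =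
      e * ρ * star (U s) + U s * ρ * star e + (U t - U s) * ρ * star (U t - U s) +
        Complex.I • (E * state U ρ s - state U ρ s * E) := by
    simp only [he, state, star_sub, star_add, star_smul, star_mul, hBsa.star_eq, Complex.star_def,
      Complex.conj_I, mul_add, add_mul, mul_sub, sub_mul, smul_add, smul_sub, smul_mul_assoc,
      mul_smul_comm, neg_smul, mul_neg, mul_assoc]
    abel
  rw [key]
  have e1 := norm_mul_mul_le hlin (le_refl ‖ρ‖) ((norm_star_eq _).trans_le (hC s hs))
  have e2 := norm_mul_mul_le (hC s hs) (le_refl ‖ρ‖) ((norm_star_eq _).trans_le hlin)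
  have e3 := norm_mul_mul_le hsub (le_refl ‖ρ‖) ((norm_star_eq _).trans_le hsub)
  have e4 : ‖Complex.I • (E * state U ρ s - state U ρ s * E)‖ ≤ 4 * (C * ‖ρ‖ * C) * v * d := by
    rwa [norm_smul, Complex.norm_I, one_mul]
  refine (norm_add_le _ _).trans ((add_le_add norm_add₃_le e4).trans ?_)
  have hR : 0 ≤ C * ‖ρ‖ * C := by positivity
  have hvd : 3 * v ^ 2 + 4 * (v * d) ≤ 7 * Δ ^ 2 := by
    rw [← hΔ]; nlinarith [mul_nonneg hv0 hd0]
  have := mul_le_mul_of_nonneg_left hvd hR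
  linarith

end QuantumCharging
end

/-! ### Composition of short steps. -/

noncomputable section
namespace QuantumCharging
open MeasureTheory Set
variable {H : Type*} [NormedAddCommGroup H] [InnerProductSpace ℂ H] [CompleteSpace H]

/-- `a` is carried to within `ε` of `b` by a unitary that turns vectors by at most `θ + ε`. -/
def UnitarilyNear (a b : H →L[ℂ] H) (θ ε : ℝ) : Prop :=
  ∃ W ∈ unitary (H →L[ℂ] H), (∀ x : H, ‖x‖ = 1 → sphereAngle x (W x) ≤ θ + ε) ∧
    ‖W * a * star W - b‖ ≤ ε

theorem norm_unitary_le_one {W : H →L[ℂ] H} (hW : W ∈ unitary (H →L[ℂ] H)) : ‖W‖ ≤ 1 :=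
  W.opNorm_le_bound zero_le_one fun x => by rw [norm_apply_of_mem_unitary hW, one_mul]

/-- Unitaries preserve angles, so the triangle inequality on the sphere adds the turns; conjugation
does not enlarge the first error. -/
theorem UnitarilyNear.trans {a b c : H →L[ℂ] H} {θ₁ θ₂ ε₁ ε₂ : ℝ}
    (h₁ : UnitarilyNear a b θ₁ ε₁) (h₂ : UnitarilyNear b c θ₂ ε₂) :
    UnitarilyNear a c (θ₁ + θ₂) (ε₁ + ε₂) := by
  obtain ⟨W₁, hW₁, hang₁, hab⟩ := h₁
  obtain ⟨W₂, hW₂, hang₂, hbc⟩ := h₂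
  refine ⟨W₂ * W₁, mul_mem hW₂ hW₁, fun x hx => ?_, ?_⟩
  · have hx₁ := (norm_apply_of_mem_unitary hW₁ x).trans hx
    have hx₂ := (norm_apply_of_mem_unitary hW₂ x).trans hx
    have hx₃ := (norm_apply_of_mem_unitary hW₂ (W₁ x)).trans hx₁
    have h := sphereAngle_triangle hx hx₂ hx₃
    rw [sphereAngle_map hW₂] at h
    have := hang₁ x hx
    have := hang₂ x hx
    change sphereAngle x (W₂ (W₁ x)) ≤ _
    linarith
  · have : W₂ * W₁ * a * star (W₂ * W₁) - c =
        W₂ * (W₁ * a * star W₁ - b) * star W₂ + (W₂ * b * star W₂ - c) := by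
      rw [star_mul]; noncomm_ring
    rw [this]
    have h := norm_mul_mul_le (norm_unitary_le_one hW₂) hab
      ((norm_star_eq W₂).trans_le (norm_unitary_le_one hW₂))
    refine (norm_add_le _ _).trans ?_
    linarith

/-- The evolution over a short time. -/
theorem unitarilyNear_state_of_short {T : ℝ} {V U D : ℝ → H →L[ℂ] H} {ρ : H →L[ℂ] H}
    (hV : IsHamiltonian T V) (hU : IsPropagator T V U) (hD : IsHamiltonian T D)
    (hcomm : ∀ t ∈ Icc 0 T, Commute (D t) (state U ρ t)) {C : ℝ} (hC0 : 0 ≤ C)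
    (hC : ∀ t ∈ Icc 0 T, ‖U t‖ ≤ C) {s t : ℝ}
    (hs : s ∈ Icc 0 T) (ht : t ∈ Icc 0 T) (hst : s ≤ t)
    (hΔ : (∫ u in s..t, (‖V u‖ + ‖D u‖)) ≤ 1) :
    UnitarilyNear (state U ρ s) (state U ρ t) (∫ u in s..t, ‖V u + D u‖)
      ((13 * (C * ‖ρ‖ * C) + 5) * (∫ u in s..t, (‖V u‖ + ‖D u‖)) ^ 2) := by
  have hB : IsSelfAdjoint (∫ u in s..t, (V u + D u)) := isSelfAdjoint_integral hst fun u hu =>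
    (hV.selfAdjoint u (Icc_subset_Icc hs.1 ht.2 hu)).add
      (hD.selfAdjoint u (Icc_subset_Icc hs.1 ht.2 hu))
  have hBb : ‖∫ u in s..t, (V u + D u)‖ ≤ ∫ u in s..t, ‖V u + D u‖ :=
    intervalIntegral.norm_integral_le_integral_norm hst
  have hbΔ : (∫ u in s..t, ‖V u + D u‖) ≤ ∫ u in s..t, (‖V u‖ + ‖D u‖) :=
    intervalIntegral.integral_mono_on hst ((hV.mono hs ht).add (hD.mono hs ht)).norm
      ((hV.mono hs ht).norm.add (hD.mono hs ht).norm) fun u _ => norm_add_le _ _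
  have hR : 0 ≤ C * ‖ρ‖ * C := by positivity
  have h1 := norm_conj_exp_sub_le hB (hBb.trans hbΔ) hΔ (norm_state_le (ρ := ρ) (hC s hs))
  have h2 := norm_state_sub_commutator_le hV hU hD hcomm hC0 hC hs ht hst rfl
  -- One error term serves both bounds: `13 = 6 + 7` from the two expansions of the state, `5` from
  -- the angle.
  refine ⟨_, exp_neg_I_smul_mem_unitary hB, fun x hx => ?_, ?_⟩
  · refine (sphereAngle_exp_le hB hBb hbΔ hΔ hx).trans ?_
    gcongr
    linarith
  · rw [norm_sub_rev] at h2
    refine (norm_sub_le_norm_sub_add_norm_sub _ _ _).trans ((add_le_add h1 h2).trans ?_)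
    nlinarith [sq_nonneg (∫ u in s..t, (‖V u‖ + ‖D u‖))]

theorem exists_integral_eq_half {g : ℝ → ℝ} {s t : ℝ} (hst : s ≤ t)
    (hg : IntervalIntegrable g volume s t) (h0 : ∀ u, 0 ≤ g u) :
    ∃ m ∈ Icc s t, (∫ u in s..m, g u) = (∫ u in s..t, g u) / 2 ∧
      (∫ u in m..t, g u) = (∫ u in s..t, g u) / 2 := by
  have hcont : ContinuousOn (fun m => ∫ u in s..m, g u) (Icc s t) := by
    rw [← uIcc_of_le hst]
    exact intervalIntegral.continuousOn_primitive_interval'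
      hg left_mem_uIcc
  have hnn : 0 ≤ ∫ u in s..t, g u := intervalIntegral.integral_nonneg hst fun u _ => h0 u
  obtain ⟨m, hm, hm'⟩ := intermediate_value_Icc hst hcont
    (show (∫ u in s..t, g u) / 2 ∈ _ by
      rw [intervalIntegral.integral_same]; constructor <;> linarith)
  refine ⟨m, hm, hm', ?_⟩
  have hm'' : m ∈ uIcc s t := by rwa [uIcc_of_le hst]
  have h := intervalIntegral.integral_add_adjacent_intervals
    (hg.mono_set (uIcc_subset_uIcc left_mem_uIcc hm''))
    (hg.mono_set (uIcc_subset_uIcc hm'' right_mem_uIcc))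
  simp only at hm'
  linarith

/-- Each interval is split where `∫ (‖V‖ + ‖D‖)` is halved, rather than at its midpoint in time. Two
errors `K (Δ / 2)²` sum to half of `KΔ²`, while the angle bound is exactly additive. -/
theorem unitarilyNear_state {T : ℝ} {V U D : ℝ → H →L[ℂ] H} {ρ : H →L[ℂ] H}
    (hV : IsHamiltonian T V) (hU : IsPropagator T V U) (hD : IsHamiltonian T D)
    (hcomm : ∀ t ∈ Icc 0 T, Commute (D t) (state U ρ t)) {C : ℝ} (hC0 : 0 ≤ C)
    (hC : ∀ t ∈ Icc 0 T, ‖U t‖ ≤ C) (n : ℕ) : ∀ {s t : ℝ}, s ∈ Icc 0 T → t ∈ Icc 0 T → s ≤ t →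
    (∫ u in s..t, (‖V u‖ + ‖D u‖)) ≤ 2 ^ n →
    UnitarilyNear (state U ρ s) (state U ρ t) (∫ u in s..t, ‖V u + D u‖)
      ((13 * (C * ‖ρ‖ * C) + 5) * (∫ u in s..t, (‖V u‖ + ‖D u‖)) ^ 2 / 2 ^ n) := by
  induction n with
  | zero =>
    intro s t hs ht hst h
    simpa using unitarilyNear_state_of_short hV hU hD hcomm hC0 hC hs ht hst (by simpa using h)
  | succ n ih =>
    intro s t hs ht hst h
    obtain ⟨m, hm, h1, h2⟩ := exists_integral_eq_half hst
      ((hV.mono hs ht).norm.add (hD.mono hs ht).norm) fun u => by positivity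
    have hm' := Icc_subset_Icc hs.1 ht.2 hm
    have hle : (∫ u in s..t, (‖V u‖ + ‖D u‖)) / 2 ≤ 2 ^ n := by
      rw [pow_succ] at h; linarith
    have e1 := ih hs hm' hm.1 (h1.trans_le hle)
    have e2 := ih hm' ht hm.2 (h2.trans_le hle)
    have e := e1.trans e2
    rw [intervalIntegral.integral_add_adjacent_intervals
      ((hV.mono hs hm').add (hD.mono hs hm')).norm
      ((hV.mono hm' ht).add (hD.mono hm' ht)).norm, h1, h2] at e
    convert e using 1
    rw [pow_succ]
    field_simp
    ring

/-! ### Generators, compactness and the minimal charging time. -/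

theorem isClosed_unitary_clm : IsClosed (unitary (H →L[ℂ] H) : Set (H →L[ℂ] H)) := by
  have : (unitary (H →L[ℂ] H) : Set (H →L[ℂ] H)) =
      {W | star W * W = 1} ∩ {W | W * star W = 1} := by
    ext W; exact Unitary.mem_iff
  rw [this]
  exact (isClosed_eq (by fun_prop) continuous_const).inter
    (isClosed_eq (by fun_prop) continuous_const)

theorem isHamiltonian_zero (T : ℝ) : IsHamiltonian T (fun _ => (0 : H →L[ℂ] H)) :=
  ⟨fun _ _ => IsSelfAdjoint.zero _, intervalIntegrable_const⟩

theorem IsHamiltonian.of_le {T t : ℝ} {V : ℝ → H →L[ℂ] H} (hV : IsHamiltonian T V)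
    (ht : t ∈ Icc 0 T) : IsHamiltonian t V :=
  ⟨fun s hs => hV.selfAdjoint s ⟨hs.1, hs.2.trans ht.2⟩,
    hV.mono ⟨le_rfl, ht.1.trans ht.2⟩ ht⟩

theorem isHamiltonian_const {A : H →L[ℂ] H} (hA : IsSelfAdjoint A) (T : ℝ) :
    IsHamiltonian T fun _ => A :=
  ⟨fun _ _ => hA, intervalIntegrable_const⟩

/-- The self-adjoint generators of unitaries that take `ρ` to `σ`. -/
def generators (ρ σ : H →L[ℂ] H) : Set (H →L[ℂ] H) :=
  {A | IsSelfAdjoint A ∧ NormedSpace.exp (-(Complex.I • A)) * ρ *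
    star (NormedSpace.exp (-(Complex.I • A))) = σ}

/-- A generator `A` gives a constant Hamiltonian `A / T`, for any duration `T`. -/
theorem state_const_of_mem_generators {ρ σ A : H →L[ℂ] H} (hA : A ∈ generators ρ σ) {T : ℝ}
    (hT : T ≠ 0) :
    state (fun t => NormedSpace.exp (t • -(Complex.I • (T⁻¹ • A)))) ρ T = σ := by
  have : T • -(Complex.I • (T⁻¹ • A)) = -(Complex.I • A) := by
    rw [smul_neg, smul_comm, smul_smul, mul_inv_cancel₀ hT, one_smul]
  simp only [state, this]
  exact hA.2

theorem eq_of_zero_mem_generators {ρ σ : H →L[ℂ] H} (h : 0 ∈ generators ρ σ) : ρ = σ := by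
  simpa using h.2

theorem isPropagator_const (T : ℝ) (A : H →L[ℂ] H) :
    IsPropagator T (fun _ => A) fun t => NormedSpace.exp (t • -(Complex.I • A)) := by
  have hd (t : ℝ) := hasDerivAt_exp_smul_const' (𝕂 := ℝ) (-(Complex.I • A)) t
  have hc : Continuous fun t : ℝ => NormedSpace.exp (t • -(Complex.I • A)) :=
    continuous_iff_continuousAt.2 fun t => (hd t).continuousAt
  refine ⟨hc.continuousOn, fun t _ => ?_⟩
  have h := intervalIntegral.integral_eq_sub_of_hasDerivAt (a := 0) (b := t) (fun s _ => hd s)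
    ((continuous_const.mul hc).intervalIntegrable _ _)
  rw [zero_smul, NormedSpace.exp_zero] at h
  simp only [neg_mul, smul_mul_assoc, intervalIntegral.integral_neg,
    intervalIntegral.integral_smul] at h
  rw [sub_eq_add_neg, h]
  abel

theorem isClosed_generators (ρ σ : H →L[ℂ] H) : IsClosed (generators ρ σ) := by
  let := NormedAlgebra.restrictScalars ℚ ℂ (H →L[ℂ] H)
  have hexp : Continuous (NormedSpace.exp : (H →L[ℂ] H) → H →L[ℂ] H) :=
    NormedSpace.exp_continuous
  exact (isClosed_eq continuous_star continuous_id).inter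
    (isClosed_eq (by fun_prop) continuous_const)

theorem norm_mem_chargingTimes [Nontrivial H] {ρ σ A : H →L[ℂ] H} (hA : A ∈ generators ρ σ) :
    ‖A‖ ∈ chargingTimes ρ σ := by
  refine ⟨norm_nonneg A, ?_⟩
  by_cases h0 : A = 0
  -- The duration is `0`, but the norm must still be `1` at time `0`; the identity serves as
  -- Hamiltonian.
  · subst h0
    refine ⟨_, _, isHamiltonian_const (.one _) _, fun _ _ => norm_one, isPropagator_const _ 1, ?_⟩
    simpa [state] using eq_of_zero_mem_generators hA
  · have hn : ‖A‖ ≠ 0 := norm_ne_zero_iff.2 h0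
    have hsa : IsSelfAdjoint (‖A‖⁻¹ • A) := (IsSelfAdjoint.all _).smul hA.1
    refine ⟨_, _, isHamiltonian_const hsa _, fun _ _ => ?_, isPropagator_const _ _,
      state_const_of_mem_generators hA hn⟩
    rw [norm_smul, norm_inv, norm_norm, inv_mul_cancel₀ hn]

variable [FiniteDimensional ℂ H]

instance properSpace_clm : ProperSpace (H →L[ℂ] H) := FiniteDimensional.proper ℂ _

theorem isCompact_unitary_clm : IsCompact (unitary (H →L[ℂ] H) : Set (H →L[ℂ] H)) :=
  (isCompact_closedBall (0 : H →L[ℂ] H) 1).of_isClosed_subset isClosed_unitary_clm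
    fun W hW => by simpa using norm_unitary_le_one hW

/-- Both conditions are closed in `W`, so they survive along a convergent subsequence of unitaries.
-/
theorem exists_unitary_of_unitarilyNear {a b : H →L[ℂ] H} {θ : ℝ} {ε : ℕ → ℝ}
    (hε : Filter.Tendsto ε Filter.atTop (nhds 0))
    (h : ∀ᶠ n in Filter.atTop, UnitarilyNear a b θ (ε n)) :
    ∃ W ∈ unitary (H →L[ℂ] H), (∀ x : H, ‖x‖ = 1 → sphereAngle x (W x) ≤ θ) ∧
      W * a * star W = b := by
  obtain ⟨N, hN⟩ := Filter.eventually_atTop.1 h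
  choose W hW hang hnear using fun n : ℕ => hN (n + N) (Nat.le_add_left _ _)
  have hε' := hε.comp (Filter.tendsto_add_atTop_nat N)
  obtain ⟨W₀, hW₀, φ, hφ, hlim⟩ := isCompact_unitary_clm.tendsto_subseq hW
  have hε'' := hε'.comp hφ.tendsto_atTop
  refine ⟨W₀, hW₀, fun x hx => ?_, ?_⟩
  · have hc : Continuous fun Z : H →L[ℂ] H => sphereAngle x (Z x) := by
      unfold sphereAngle
      exact Real.continuous_arccos.comp (Complex.continuous_re.comp (by fun_prop))
    refine le_of_tendsto_of_tendsto' ((hc.tendsto W₀).comp hlim)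
      (by simpa using hε''.const_add θ) fun n => hang (φ n) x hx
  · have hc : Continuous fun Z : H →L[ℂ] H => ‖Z * a * star Z - b‖ := by fun_prop
    have := le_of_tendsto_of_tendsto' ((hc.tendsto W₀).comp hlim) hε'' fun n => hnear (φ n)
    exact sub_eq_zero.1 (norm_le_zero_iff.1 this)

/-- An evolution whose Hamiltonian, up to terms that commute with the state, has total norm `L`
is implemented by a unitary that turns vectors by at most `L`. -/
theorem exists_unitary_of_evolution {T : ℝ} (hT : 0 ≤ T) {V U D : ℝ → H →L[ℂ] H}
    {ρ : H →L[ℂ] H} (hV : IsHamiltonian T V) (hU : IsPropagator T V U) (hD : IsHamiltonian T D)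
    (hcomm : ∀ t ∈ Icc 0 T, Commute (D t) (state U ρ t)) :
    ∃ W ∈ unitary (H →L[ℂ] H),
      (∀ x : H, ‖x‖ = 1 → sphereAngle x (W x) ≤ ∫ t in (0 : ℝ)..T, ‖V t + D t‖) ∧
      W * ρ * star W = state U ρ T := by
  obtain ⟨C, hC0, hC⟩ := hU.exists_bound
  have h0 : (0 : ℝ) ∈ Icc 0 T := ⟨le_rfl, hT⟩
  have hU0 : state U ρ 0 = ρ := by
    have : U 0 = 1 := by simpa using hU.schrodinger 0 h0
    simp [state, this]
  have hpow : Filter.Tendsto (fun n : ℕ => (2 : ℝ) ^ n) Filter.atTop Filter.atTop :=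
    tendsto_pow_atTop_atTop_of_one_lt one_lt_two
  have := exists_unitary_of_unitarilyNear (a := state U ρ 0) (b := state U ρ T)
    (θ := ∫ t in (0 : ℝ)..T, ‖V t + D t‖)
    (hpow.const_div_atTop
      ((13 * (C * ‖ρ‖ * C) + 5) * (∫ u in (0 : ℝ)..T, (‖V u‖ + ‖D u‖)) ^ 2)) (by
    filter_upwards [hpow.eventually_ge_atTop (∫ u in (0 : ℝ)..T, (‖V u‖ + ‖D u‖))] with n hn
    exact unitarilyNear_state hV hU hD hcomm hC0 hC n h0 ⟨hT, le_rfl⟩ hT hn)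
  rwa [hU0] at this

/-- Taking `ρ = 1` and `D = 0` gives `U U† = W W† = 1`; in finite dimension a right inverse is
two-sided. -/
theorem IsPropagator.mem_unitary {T t : ℝ} {V U : ℝ → H →L[ℂ] H} (hV : IsHamiltonian T V)
    (hU : IsPropagator T V U) (ht : t ∈ Icc 0 T) : U t ∈ unitary (H →L[ℂ] H) := by
  obtain ⟨W, hW, -, h⟩ := exists_unitary_of_evolution (ρ := 1) ht.1 (hV.of_le ht) (hU.of_le ht)
    (isHamiltonian_zero t) fun _ _ => Commute.zero_left _
  have h1 : U t * star (U t) = 1 := by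
    rw [mul_one, (Unitary.mem_iff.1 hW).2] at h
    simpa [state] using h.symm
  refine Unitary.mem_iff.2 ⟨?_, h1⟩
  have h2 : (U t : H →ₗ[ℂ] H) * (star (U t) : H →L[ℂ] H) = 1 := by
    ext x; exact congrArg (fun Z : H →L[ℂ] H => Z x) h1
  have h3 := mul_eq_one_comm.1 h2
  ext x
  exact congrArg (fun Z : H →ₗ[ℂ] H => Z x) h3

theorem exists_generator_of_evolution {T : ℝ} (hT : 0 ≤ T) {V U D : ℝ → H →L[ℂ] H}
    {ρ σ : H →L[ℂ] H} (hV : IsHamiltonian T V) (hU : IsPropagator T V U)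
    (hσ : state U ρ T = σ) (hD : IsHamiltonian T D)
    (hcomm : ∀ t ∈ Icc 0 T, Commute (D t) (state U ρ t)) :
    ∃ A ∈ generators ρ σ, ‖A‖ ≤ ∫ t in (0 : ℝ)..T, ‖V t + D t‖ := by
  obtain ⟨W, hW, hang, h⟩ := exists_unitary_of_evolution hT hV hU hD hcomm
  obtain ⟨A, hA, hAn, rfl⟩ := exists_selfAdjoint_log hW
    (intervalIntegral.integral_nonneg hT fun _ _ => norm_nonneg _) hang
  exact ⟨A, ⟨hA, h.trans hσ⟩, hAn⟩

theorem exists_generator_of_propagator {T : ℝ} (hT : 0 ≤ T) {V U : ℝ → H →L[ℂ] H}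
    {ρ σ : H →L[ℂ] H} (hV : IsHamiltonian T V) (hU : IsPropagator T V U)
    (hσ : state U ρ T = σ) :
    ∃ A ∈ generators ρ σ, ‖A‖ ≤ ∫ t in (0 : ℝ)..T, ‖V t‖ := by
  simpa using exists_generator_of_evolution hT hV hU hσ (isHamiltonian_zero T)
    fun _ _ => Commute.zero_left _

theorem exists_minimal_generator {ρ σ : H →L[ℂ] H} (h : (generators ρ σ).Nonempty) :
    ∃ A ∈ generators ρ σ, ∀ B ∈ generators ρ σ, ‖A‖ ≤ ‖B‖ := by
  obtain ⟨A, hA, hmin⟩ := (isClosed_generators ρ σ).exists_infDist_eq_dist h 0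
  refine ⟨A, hA, fun B hB => ?_⟩
  simpa [hmin] using Metric.infDist_le_dist_of_mem (x := 0) hB

theorem isLeast_chargingTimes [Nontrivial H] {ρ σ A : H →L[ℂ] H} (hA : A ∈ generators ρ σ)
    (hmin : ∀ B ∈ generators ρ σ, ‖A‖ ≤ ‖B‖) : IsLeast (chargingTimes ρ σ) ‖A‖ := by
  refine ⟨norm_mem_chargingTimes hA, fun T hT => ?_⟩
  obtain ⟨hT0, V, U, hV, hV1, hU, hσ⟩ := hT
  obtain ⟨B, hB, hBn⟩ := exists_generator_of_propagator hT0 hV hU hσ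
  refine (hmin B hB).trans (hBn.trans_eq ?_)
  rw [intervalIntegral.integral_congr (g := fun _ => (1 : ℝ)) fun t ht => hV1 t (by
    rwa [uIcc_of_le hT0] at ht)]
  simp

end QuantumCharging
end

/-! ### Measurable best approximation and the minimum over commuting Hamiltonians. -/

noncomputable section
namespace QuantumCharging
open MeasureTheory Set

section Selection
variable {E X : Type*} [NormedAddCommGroup E] [NormedSpace ℝ E]
  [NormedAddCommGroup X] [InnerProductSpace ℝ X]

/-- The pairs `(v, x)` for which `x` minimises `‖v + φ x‖`. -/
def minimisers (φ : X →L[ℝ] E) : Set (E × X) :=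
  {p | ∀ y, ‖p.1 + φ p.2‖ ≤ ‖p.1 + φ y‖}

theorem isClosed_minimisers (φ : X →L[ℝ] E) : IsClosed (minimisers φ) := by
  simp only [minimisers, ofPred_forall]
  exact isClosed_iInter fun y => isClosed_le (by fun_prop) (by fun_prop)

theorem half_smul_add_mem_minimisers {φ : X →L[ℝ] E} {v : E} {x y : X}
    (hx : (v, x) ∈ minimisers φ) (hy : (v, y) ∈ minimisers φ) :
    (v, (1 / 2 : ℝ) • (x + y)) ∈ minimisers φ := by
  intro z
  have h1 := hx z
  have h2 := hy z
  have h : v + φ ((1 / 2 : ℝ) • (x + y)) = (1 / 2 : ℝ) • ((v + φ x) + (v + φ y)) := by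
    rw [map_smul, map_add]; module
  simp only [h, norm_smul] at h1 h2 ⊢
  have h3 := norm_add_le (v + φ x) (v + φ y)
  norm_num
  linarith

variable [FiniteDimensional ℝ X]

/-- An injective linear map from a finite-dimensional space is bounded below, so the norm to be
minimised is coercive. -/
theorem exists_mem_minimisers {φ : X →L[ℝ] E} (hφ : Function.Injective φ) (v : E) :
    ∃ x, (v, x) ∈ minimisers φ := by
  obtain ⟨K, hK, hanti⟩ := LinearMap.exists_antilipschitzWith (φ : X →ₗ[ℝ] E)
    (LinearMap.ker_eq_bot.2 hφ)
  have : ProperSpace X := FiniteDimensional.proper ℝ X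
  have hφt : Filter.Tendsto (fun x => ‖φ x‖) (Filter.cocompact X) Filter.atTop := by
    refine Filter.tendsto_atTop_mono (f := fun x => ‖x‖ / K) (fun x => ?_)
      ((tendsto_norm_cocompact_atTop (E := X)).atTop_div_const (by exact_mod_cast hK))
    rw [div_le_iff₀ (by exact_mod_cast hK), mul_comm]
    simpa using hanti.le_mul_dist x 0
  have ht : Filter.Tendsto (fun x => ‖v + φ x‖) (Filter.cocompact X) Filter.atTop := by
    refine Filter.tendsto_atTop_mono (f := fun x => ‖φ x‖ + -‖v‖) (fun x => ?_)
      (Filter.tendsto_atTop_add_const_right _ _ hφt)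
    have := norm_sub_norm_le (φ x) (-v)
    rw [norm_neg, sub_neg_eq_add, add_comm (φ x)] at this
    linarith
  exact Continuous.exists_forall_le (by fun_prop) ht

variable [ProperSpace E] [MeasurableSpace E] [BorelSpace E] [MeasurableSpace X] [BorelSpace X]

/-- A Borel selection of best approximations: the minimiser of least Euclidean norm. -/
theorem exists_measurable_minimiser {φ : X →L[ℝ] E} (hφ : Function.Injective φ) :
    ∃ f : E → X, Measurable f ∧ ∀ v, (v, f v) ∈ minimisers φ := by
  have : ProperSpace X := FiniteDimensional.proper ℝ X
  have hG := isClosed_minimisers φ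
  have hex : ∀ v, ∃ x, (v, x) ∈ minimisers φ ∧ ∀ y, (v, y) ∈ minimisers φ → ‖x‖ ≤ ‖y‖ := by
    intro v
    have hc : IsClosed {x | (v, x) ∈ minimisers φ} := hG.preimage (by fun_prop)
    obtain ⟨x, hx, hmin⟩ := hc.exists_infDist_eq_dist (exists_mem_minimisers hφ v) 0
    refine ⟨x, hx, fun y hy => ?_⟩
    simpa [hmin] using Metric.infDist_le_dist_of_mem (x := 0) (s := {x | (v, x) ∈ minimisers φ}) hy
  choose f hf hfmin using hex
  refine ⟨f, ?_, hf⟩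
  -- Sublevel sets of `‖f v‖` are projections of closed sets along a compact ball, hence closed.
  have hnorm : Measurable fun v => ‖f v‖ := by
    refine measurable_of_Iic fun c => IsClosed.measurableSet ?_
    have : (fun v => ‖f v‖) ⁻¹' Iic c =
        Prod.fst '' {p : E × Metric.closedBall (0 : X) c | (p.1, (p.2 : X)) ∈ minimisers φ} := by
      ext v
      constructor
      · intro hv
        exact ⟨(v, ⟨f v, by simpa using hv⟩), hf v, rfl⟩
      · rintro ⟨⟨w, x⟩, hx, rfl⟩
        exact (hfmin w x hx).trans (mem_closedBall_zero_iff.1 x.2)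
    rw [this]
    have : CompactSpace (Metric.closedBall (0 : X) c) :=
      isCompact_iff_compactSpace.1 (isCompact_closedBall 0 c)
    exact isClosedMap_fst_of_compactSpace _ (hG.preimage (by fun_prop))
  -- The Euclidean norm is strictly convex: the midpoint of two distinct minimisers of equal norm
  -- would be a shorter minimiser.
  have hgraph : {p : E × X | p.2 = f p.1} = minimisers φ ∩ {p | ‖p.2‖ = ‖f p.1‖} := by
    ext ⟨v, x⟩
    constructor
    · rintro (rfl : x = f v)
      exact ⟨hf v, rfl⟩
    · rintro ⟨hx, hxn : ‖x‖ = ‖f v‖⟩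
      by_contra hne
      have h1 := (norm_midpoint_lt_iff hxn).2 hne
      have h2 := hfmin v _ (half_smul_add_mem_minimisers hx (hf v))
      linarith
  have hmeas : MeasurableSet {p : E × X | p.2 = f p.1} := by
    rw [hgraph]
    exact hG.measurableSet.inter (measurableSet_eq_fun (by fun_prop) (hnorm.comp measurable_fst))
  intro B hB
  have : f ⁻¹' B = Prod.fst '' ({p : E × X | p.2 = f p.1} ∩ Prod.snd ⁻¹' B) := by
    ext v
    constructor
    · intro hv
      exact ⟨(v, f v), ⟨rfl, hv⟩, rfl⟩
    · rintro ⟨⟨w, x⟩, ⟨hw : x = f w, hx⟩, rfl⟩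
      exact hw ▸ hx
  rw [this]
  -- Lusin–Souslin: the first projection is injective on the graph, so it takes Borel subsets of the
  -- graph to Borel sets.
  refine (hmeas.inter (measurable_snd hB)).image_of_measurable_injOn measurable_fst ?_
  rintro ⟨v, x⟩ ⟨hx : x = f v, -⟩ ⟨w, y⟩ ⟨hy : y = f w, -⟩ (rfl : v = w)
  rw [hx, hy]

end Selection

/-- The norm of `E` need not be strictly convex; Euclidean coordinates on `M` supply the tie-break.
-/
theorem exists_measurable_best_approximation {E : Type*} [NormedAddCommGroup E]
    [NormedSpace ℝ E] [ProperSpace E] [MeasurableSpace E] [BorelSpace E] (M : Submodule ℝ E) [FiniteDimensional ℝ M] :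
    ∃ f : E → E, Measurable f ∧ ∀ v, f v ∈ M ∧ ∀ d ∈ M, ‖v + f v‖ ≤ ‖v + d‖ := by
  let e := toEuclidean (E := M)
  let φ : EuclideanSpace ℝ (Fin (Module.finrank ℝ M)) →L[ℝ] E := M.subtypeL.comp (e.symm : _ →L[ℝ] M)
  have hφ : Function.Injective φ := M.subtype_injective.comp e.symm.injective
  obtain ⟨f, hf, hmin⟩ := exists_measurable_minimiser hφ
  refine ⟨fun v => φ (f v), φ.continuous.measurable.comp hf, fun v => ⟨(e.symm (f v)).2, ?_⟩⟩
  intro d hd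
  have := hmin v (e ⟨d, hd⟩)
  simpa [φ] using this

variable {H : Type*} [NormedAddCommGroup H] [InnerProductSpace ℂ H] [CompleteSpace H]

/-- The self-adjoint operators that commute with `ρ`. -/
def selfAdjointCommutant (ρ : H →L[ℂ] H) : Submodule ℝ (H →L[ℂ] H) where
  carrier := {D | IsSelfAdjoint D ∧ Commute D ρ}
  add_mem' h₁ h₂ := ⟨h₁.1.add h₂.1, h₁.2.add_left h₂.2⟩
  zero_mem' := ⟨.zero _, .zero_left _⟩
  smul_mem' c _ h := ⟨(IsSelfAdjoint.all c).smul h.1, h.2.smul_left c⟩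

theorem norm_unitary_conj {W : H →L[ℂ] H} (hW : W ∈ unitary (H →L[ℂ] H)) (X : H →L[ℂ] H) :
    ‖W * X * star W‖ = ‖X‖ := by
  rw [CStarRing.norm_mul_mem_unitary _ (Unitary.star_mem hW), CStarRing.norm_mem_unitary_mul _ hW]

theorem conj_mem_selfAdjointCommutant {W D ρ : H →L[ℂ] H} (hW : W ∈ unitary (H →L[ℂ] H))
    (hD : D ∈ selfAdjointCommutant ρ) :
    W * D * star W ∈ selfAdjointCommutant (W * ρ * star W) := by
  have h1 : star W * W = 1 := (Unitary.mem_iff.1 hW).1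
  have h (X Y : H →L[ℂ] H) : W * X * star W * (W * Y * star W) = W * (X * Y) * star W := by
    calc _ = W * X * (star W * W) * Y * star W := by noncomm_ring
      _ = _ := by rw [h1]; noncomm_ring
  refine ⟨hD.1.conjugate W, ?_⟩
  rw [Commute, SemiconjBy, h, h, hD.2.eq]

variable [FiniteDimensional ℂ H]

/-- The minimum over the Hamiltonians that commute with the state is attained. -/
theorem exists_isLeast_modifiedCosts {T : ℝ} (hT : 0 ≤ T) {V U : ℝ → H →L[ℂ] H}
    (hV : IsHamiltonian T V) (hU : IsPropagator T V U) (ρ : H →L[ℂ] H) :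
    ∃ c, IsLeast (modifiedCosts T V (state U ρ)) c := by
  have : FiniteDimensional ℝ (H →L[ℂ] H) := FiniteDimensional.complexToReal _
  obtain ⟨f, hf, hmin⟩ := exists_measurable_best_approximation (selfAdjointCommutant ρ)
  have hUu (t : ℝ) (ht : t ∈ Icc 0 T) := hU.mem_unitary hV ht
  have hconj {t : ℝ} (ht : t ∈ Icc 0 T) (X : H →L[ℂ] H) :
      U t * (star (U t) * X * U t) * star (U t) = X := by
    have h1 := (Unitary.mem_iff.1 (hUu t ht)).2
    calc _ = (U t * star (U t)) * X * (U t * star (U t)) := by noncomm_ring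
      _ = X := by rw [h1, one_mul, mul_one]
  -- The commutant of `ρ_t` is the conjugate by `U_t` of that of `ρ`, so a single selection for the
  -- fixed commutant serves all times.
  set D : ℝ → H →L[ℂ] H := fun t => U t * f (star (U t) * V t * U t) * star (U t) with hDdef
  have hmem (t : ℝ) (ht : t ∈ Icc 0 T) : D t ∈ selfAdjointCommutant (state U ρ t) :=
    conj_mem_selfAdjointCommutant (hUu t ht) (hmin _).1
  have hVD {t : ℝ} (ht : t ∈ Icc 0 T) (X : H →L[ℂ] H) :
      ‖V t + U t * X * star (U t)‖ = ‖star (U t) * V t * U t + X‖ := by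
    rw [← norm_unitary_conj (hUu t ht) (star (U t) * V t * U t + X), mul_add, add_mul,
      hconj ht]
  have hle {t : ℝ} (ht : t ∈ Icc 0 T) {D' : H →L[ℂ] H}
      (hD' : D' ∈ selfAdjointCommutant (state U ρ t)) : ‖V t + D t‖ ≤ ‖V t + D'‖ := by
    have h2 : star (U t) * D' * U t ∈ selfAdjointCommutant ρ := by
      have h3 := conj_mem_selfAdjointCommutant (Unitary.star_mem (hUu t ht)) hD'
      have h1 := (Unitary.mem_iff.1 (hUu t ht)).1
      have h4 : star (U t) * state U ρ t * star (star (U t)) = ρ := by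
        rw [star_star, state]
        calc _ = (star (U t) * U t) * ρ * (star (U t) * U t) := by noncomm_ring
          _ = ρ := by rw [h1, one_mul, mul_one]
      rwa [h4, star_star] at h3
    have h5 := (hmin (star (U t) * V t * U t)).2 _ h2
    rwa [← hVD ht, ← hVD ht, hconj ht] at h5
  -- Comparison with the competitor `0` gives the integrable majorant.
  have hDV {t : ℝ} (ht : t ∈ Icc 0 T) : ‖D t‖ ≤ 2 * ‖V t‖ := by
    have h1 := hle ht (Submodule.zero_mem _)
    rw [add_zero] at h1
    have h2 := norm_sub_norm_le (D t) (-V t)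
    rw [norm_neg, sub_neg_eq_add, add_comm (D t)] at h2
    linarith
  have hDint : IntervalIntegrable D volume 0 T := by
    rw [intervalIntegrable_iff_integrableOn_Ioc_of_le hT]
    have hVi := (intervalIntegrable_iff_integrableOn_Ioc_of_le hT).1 hV.integrable
    have hUm : AEStronglyMeasurable U (volume.restrict (Ioc 0 T)) :=
      (hU.continuousOn.mono Ioc_subset_Icc_self).aestronglyMeasurable measurableSet_Ioc
    have hUs : AEStronglyMeasurable (fun t => star (U t)) (volume.restrict (Ioc 0 T)) :=
      continuous_star.comp_aestronglyMeasurable hUm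
    refine Integrable.mono' (hVi.norm.const_mul 2) ?_ ?_
    · refine (hUm.mul (AEMeasurable.aestronglyMeasurable ?_)).mul hUs
      exact hf.comp_aemeasurable ((hUs.mul hVi.aestronglyMeasurable).mul hUm).aemeasurable
    · filter_upwards [ae_restrict_mem measurableSet_Ioc] with t ht
      exact hDV (Ioc_subset_Icc_self ht)
  have hDh : IsHamiltonian T D := ⟨fun t ht => (hmem t ht).1, hDint⟩
  refine ⟨_, ⟨D, hDh, fun t ht => (hmem t ht).2, rfl⟩, ?_⟩
  rintro c ⟨D', hD', hcomm, rfl⟩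
  exact intervalIntegral.integral_mono_on hT (hV.integrable.add hDint).norm
    (hV.integrable.add hD'.integrable).norm
    fun t ht => hle ht ⟨hD'.selfAdjoint t ht, hcomm t ht⟩

end QuantumCharging
end

/-! ### The speed limits and their achievability. -/

open MeasureTheory Set QuantumCharging in
theorem mainTheorem9 {H : Type*} [NormedAddCommGroup H] [InnerProductSpace ℂ H]
    [CompleteSpace H] [FiniteDimensional ℂ H]
    (ρ σ : H →L[ℂ] H) (hρ : IsDensity ρ)
    (T : ℝ) (hT : 0 < T) (V U : ℝ → H →L[ℂ] H)
    (hV : IsHamiltonian T V) (hU : IsPropagator T V U) (hσ : state U ρ T = σ) :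
    -- the minimum that defines `D(ρ, σ)` is attained
    IsLeast (chargingTimes ρ σ) (chargingDistance ρ σ) ∧
    -- the minimum that defines `v_mCD` is attained
    IsLeast (modifiedCosts T V (state U ρ)) (T * vmCD T V (state U ρ)) ∧
    -- the modified speed limit
    chargingDistance ρ σ ≤ T * vmCD T V (state U ρ) ∧
    tmCD T V (state U ρ) ρ σ ≤ T ∧
    -- the weaker speed limit
    chargingDistance ρ σ ≤ ∫ t in (0 : ℝ)..T, ‖V t‖ ∧
    tCD T V ρ σ ≤ T ∧
    tCD T V ρ σ ≤ tmCD T V (state U ρ) ρ σ ∧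
    -- the weaker speed limit is achievable, with any prescribed duration
    (∀ T' : ℝ, 0 < T' → ∃ V' U' : ℝ → H →L[ℂ] H,
      IsHamiltonian T' V' ∧ IsPropagator T' V' U' ∧ state U' ρ T' = σ ∧
      chargingDistance ρ σ = ∫ t in (0 : ℝ)..T', ‖V' t‖ ∧
      (ρ ≠ σ → tCD T' V' ρ σ = T')) := by
  -- Trace one excludes the zero space, where no operator has norm `1`.
  have := hρ.nontrivial
  obtain ⟨A₀, hA₀, -⟩ := exists_generator_of_propagator hT.le hV hU hσ
  obtain ⟨A, hA, hAmin⟩ := exists_minimal_generator ⟨A₀, hA₀⟩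
  have hleast := isLeast_chargingTimes hA hAmin
  have hdist : chargingDistance ρ σ = ‖A‖ := hleast.csInf_eq
  obtain ⟨c, hc⟩ := exists_isLeast_modifiedCosts hT.le hV hU ρ
  have hvm : vmCD T V (state U ρ) = c / T := by
    rw [vmCD, hc.csInf_eq]; ring
  have hTvm : T * vmCD T V (state U ρ) = c := by
    rw [hvm, mul_div_cancel₀ _ hT.ne']
  have hv : vCD T V = (∫ t in (0 : ℝ)..T, ‖V t‖) / T := by
    rw [vCD]; ring
  have hAc : ‖A‖ ≤ c := by
    obtain ⟨D, hD, hcomm, rfl⟩ := hc.1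
    obtain ⟨B, hB, hBn⟩ := exists_generator_of_evolution hT.le hV hU hσ hD hcomm
    exact (hAmin B hB).trans hBn
  have hcL : c ≤ ∫ t in (0 : ℝ)..T, ‖V t‖ :=
    hc.2 ⟨fun _ => 0, isHamiltonian_zero T, fun _ _ => Commute.zero_left _, by simp⟩
  have hA0 := norm_nonneg A
  have htime : ∀ L : ℝ, ‖A‖ ≤ L → ‖A‖ / (L / T) ≤ T := fun L hL => by
    refine div_le_of_le_mul₀ (div_nonneg (hA0.trans hL) hT.le) hT.le ?_
    rwa [mul_div_cancel₀ _ hT.ne']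
  refine ⟨hdist ▸ hleast, hTvm ▸ hc, ?_, ?_, ?_, ?_, ?_, ?_⟩
  · rwa [hdist, hTvm]
  · rw [tmCD, hdist, hvm]
    exact htime c hAc
  · rw [hdist]
    exact hAc.trans hcL
  · rw [tCD, hdist, hv]
    exact htime _ (hAc.trans hcL)
  · rw [tCD, tmCD, hdist, hv, hvm]
    -- If `c = 0`, the distance is `0` too and both quotients vanish; otherwise the smaller
    -- denominator gives the larger time.
    rcases (hA0.trans hAc).eq_or_lt with h0 | h0
    · have : ‖A‖ = 0 := le_antisymm (h0 ▸ hAc) hA0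
      simp [this]
    · exact div_le_div_of_nonneg_left hA0 (div_pos h0 hT)
        (div_le_div_of_nonneg_right hcL hT.le)
  · intro T' hT'
    have hint : ‖A‖ = ∫ _ in (0 : ℝ)..T', ‖T'⁻¹ • A‖ := by
      rw [intervalIntegral.integral_const, sub_zero, norm_smul, norm_inv, Real.norm_eq_abs,
        abs_of_pos hT', smul_eq_mul, mul_inv_cancel_left₀ hT'.ne']
    refine ⟨fun _ => T'⁻¹ • A, _, isHamiltonian_const ((IsSelfAdjoint.all _).smul hA.1) T',
      isPropagator_const T' _, state_const_of_mem_generators hA hT'.ne', hdist.trans hint, ?_⟩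
    intro hne
    have hA' : ‖A‖ ≠ 0 := by
      intro h
      rw [norm_eq_zero] at h
      exact hne (eq_of_zero_mem_generators (h ▸ hA))
    rw [tCD, vCD, hdist, ← hint]
    field_simp
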